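/- Consider first-order modal logic without equality, constants and function symbols, over countably many variables and countably infinitely many predicate symbols of each arity; its formulas are built from atoms $P(x_1,\dots,x_n)$ by $\neg$, $\wedge$, $\exists x$ and $\Box$, and $\forall x$ abbreviates $\neg\exists x\neg$. An increasing domain model consists of a non-empty countable set $W$ of worlds, a non-empty countable domain $D$, an accessibility relation $R\subseteq W\times W$, a non-empty local domain $\delta(w)\subseteq D$ for every world $w$, with $\delta(w)\subseteq\delta(v)$ whenever $(w,v)\in R$, and, for every world $w$ and every $n$-ary predicate symbol $P$, an interpretation $\rho(w,P)\subseteq\delta(w)^n$. At a world $w$ quantifiers range over $\delta(w)$, and $\Box$ means truth at all $R$-successors of $w$. A formula is satisfiable if it is true at some world $w$ of some increasing domain model under some assignment of elements of $\delta(w)$ to the variables. The fragment $\mathtt{ABEBBE}$ consists of the formulas built from atoms by $\neg$, $\wedge$, $\Box$ and the bundled operators $\forall x\Box$, $\exists x\Box$ and $\Box\exists x$ (so also their duals, up to double negations). Theorem. The satisfiability problem for $\mathtt{ABEBBE}$ over increasing domain models is undecidable: no algorithm decides, given a formula of $\mathtt{ABEBBE}$, whether it is satisfiable. -/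

import Mathlib

namespace FOML

/-- Formulas of first-order modal logic, without equality, constants and function symbols.
Variables are natural numbers, and for every arity `n` there are countably many predicate symbols
`P = 0, 1, 2, …`: the formula `atom n P x` is `P(x 0, …, x (n - 1))`. -/
inductive Form : Type
  | atom (n P : ℕ) (x : Fin n → ℕ) : Form
  | neg (φ : Form) : Form
  | and (φ ψ : Form) : Form
  | ex (x : ℕ) (φ : Form) : Form
  | box (φ : Form) : Form

/-- `∀ x φ`, defined as `¬ ∃ x ¬ φ`. -/
def Form.all (x : ℕ) (φ : Form) : Form := .neg (.ex x (.neg φ))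

/-- Increasing domain models. -/
structure Model where
  World : Type
  Dom : Type
  [worldNonempty : Nonempty World]
  [worldCountable : Countable World]
  [domNonempty : Nonempty Dom]
  [domCountable : Countable Dom]
  /-- the local domain of each world -/
  δ : World → Set Dom
  /-- the accessibility relation -/
  R : World → World → Prop
  /-- the interpretation of the `n`-ary predicate symbol `P` at each world -/
  ρ : World → (n P : ℕ) → Set (Fin n → Dom)
  δ_nonempty : ∀ w, (δ w).Nonempty
  δ_mono : ∀ w v, R w v → δ w ⊆ δ v
  ρ_local : ∀ w n P a, a ∈ ρ w n P → ∀ i, a i ∈ δ w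

/-- The assignment `σ` is relevant at the world `w`. -/
def Model.Relevant (M : Model) (w : M.World) (σ : ℕ → M.Dom) : Prop := ∀ x, σ x ∈ M.δ w

/-- `M.Sat w σ φ` is the satisfaction relation `M, w, σ ⊨ φ`. -/
def Model.Sat (M : Model) : M.World → (ℕ → M.Dom) → Form → Prop
  | w, σ, .atom n P x => (fun i => σ (x i)) ∈ M.ρ w n P
  | w, σ, .neg φ => ¬ M.Sat w σ φ
  | w, σ, .and φ ψ => M.Sat w σ φ ∧ M.Sat w σ ψ
  | w, σ, .ex x φ => ∃ d ∈ M.δ w, M.Sat w (Function.update σ x d) φ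
  | w, σ, .box φ => ∀ u, M.R w u → M.Sat u σ φ

/-- Satisfiability over increasing domain models. -/
def Satisfiable (φ : Form) : Prop :=
  ∃ (M : Model) (w : M.World) (σ : ℕ → M.Dom), M.Relevant w σ ∧ M.Sat w σ φ

/-- The four bundles of one quantifier and one modality. -/
inductive Bundle : Type
  | allBox
  | exBox
  | boxAll
  | boxEx

def Bundle.apply : Bundle → ℕ → Form → Form
  | .allBox, x, φ => .all x (.box φ)
  | .exBox, x, φ => .ex x (.box φ)
  | .boxAll, x, φ => .box (.all x φ)
  | .boxEx, x, φ => .box (.ex x φ)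

/-- Membership in the bundled fragment with the bundles in `B`: the formulas built from atoms by
negation, conjunction, `□` and the bundles in `B`. The dual operators are obtained by negation. -/
inductive IsBundled (B : Set Bundle) : Form → Prop
  | atom (n P : ℕ) (x : Fin n → ℕ) : IsBundled B (.atom n P x)
  | neg {φ : Form} (h : IsBundled B φ) : IsBundled B (.neg φ)
  | and {φ ψ : Form} (h : IsBundled B φ) (k : IsBundled B ψ) : IsBundled B (.and φ ψ)
  | box {φ : Form} (h : IsBundled B φ) : IsBundled B (.box φ)
  | bundle (b : Bundle) (hb : b ∈ B) (x : ℕ) {φ : Form} (h : IsBundled B φ) :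
      IsBundled B (b.apply x φ)

/-- The fragment with the bundles `∀ x □`, `∃ x □` and `□ ∃ x`. -/
def ABEBBE : Set Form := {φ | IsBundled {.allBox, .exBox, .boxEx} φ}

/-- A formula written as a word over `ℕ`, in prefix notation. -/
def Form.code : Form → List ℕ
  | .atom n P x => 0 :: n :: P :: List.ofFn x
  | .neg φ => 1 :: φ.code
  | .and φ ψ => 2 :: (φ.code ++ ψ.code)
  | .ex x φ => 3 :: x :: φ.code
  | .box φ => 4 :: φ.code

theorem Form.code_append_inj (φ : Form) : ∀ (ψ : Form) (s t : List ℕ),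
    φ.code ++ s = ψ.code ++ t → φ = ψ ∧ s = t := by
  induction φ with
  | atom n P x =>
    intro ψ s t h
    cases ψ with
    | atom m Q y =>
      simp only [code, List.cons_append, List.cons.injEq, true_and] at h
      obtain ⟨rfl, rfl, h⟩ := h
      obtain ⟨h1, h2⟩ := List.append_inj h (by simp)
      exact ⟨by rw [List.ofFn_injective h1], h2⟩
    | _ => simp [code] at h
  | neg φ ih =>
    intro ψ s t h
    cases ψ with
    | neg ψ =>
      simp only [code, List.cons_append, List.cons.injEq, true_and] at h
      obtain ⟨rfl, rfl⟩ := ih _ _ _ h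
      exact ⟨rfl, rfl⟩
    | _ => simp [code] at h
  | and φ φ' ih ih' =>
    intro ψ s t h
    cases ψ with
    | and ψ ψ' =>
      simp only [code, List.cons_append, List.cons.injEq, true_and, List.append_assoc] at h
      obtain ⟨rfl, h2⟩ := ih _ _ _ h
      obtain ⟨rfl, rfl⟩ := ih' _ _ _ h2
      exact ⟨rfl, rfl⟩
    | _ => simp [code] at h
  | ex x φ ih =>
    intro ψ s t h
    cases ψ with
    | ex y ψ =>
      simp only [code, List.cons_append, List.cons.injEq, true_and] at h
      obtain ⟨rfl, h⟩ := h
      obtain ⟨rfl, rfl⟩ := ih _ _ _ h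
      exact ⟨rfl, rfl⟩
    | _ => simp [code] at h
  | box φ ih =>
    intro ψ s t h
    cases ψ with
    | box ψ =>
      simp only [code, List.cons_append, List.cons.injEq, true_and] at h
      obtain ⟨rfl, rfl⟩ := ih _ _ _ h
      exact ⟨rfl, rfl⟩
    | _ => simp [code] at h

theorem Form.code_injective : Function.Injective Form.code := fun φ ψ h =>
  (φ.code_append_inj ψ [] [] (by rw [h])).1

/-- The satisfiability problem for the set `L` of formulas is decidable: an algorithm answers
correctly on the code of every formula of `L`; nothing is required of it on other inputs. -/
def SatDecidable (L : Set Form) : Prop :=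
  ∃ A : List ℕ → Bool, Computable A ∧ ∀ φ ∈ L, (A φ.code = true ↔ Satisfiable φ)

end FOML

/-!
The halting problem is reduced to the complement of the satisfiability problem.

Two features of the fragment suffice. The bundle `◇ ∀ x`, dual to `□ ∃ x`, lets `∃ y □` follow a
universal quantifier inside one world: at some world `v` the formula `◇ ∀ x ∃ y □ ⋯ □ S(x, y)`
yields a serial relation on `δ(v)` that is present at all worlds at a fixed distance `k` from `v`.
The bundle `∀ x □`, iterated `k` times from `v`, imposes a quantifier-free formula on all `k`-tuples
of elements of `δ(v)`, evaluated at these same worlds, because local domains only grow. So a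
sentence `∀ x ∃ y S(x, y) ∧ ∃ y Z(y) ∧ ∀ x₀ ⋯ ∀ xₖ₋₁ ψ` of first-order logic, with `ψ`
quantifier-free, can be expressed by a formula of the fragment (`reduction`).

Such sentences can describe computations. Each code `c` of a partial recursive function gets a
binary predicate symbol, and Horn clauses (`evalAxioms`) that mirror the defining equations of
`Nat.Partrec.Code.eval`; auxiliary clauses (`pairAxioms`) do the same for the pairing function.
In any model the elements `s(s(⋯ z))` serve as numerals, where `z` witnesses `∃ y Z(y)` and `s`
chooses witnesses of `∀ x ∃ y S(x, y)`. Horn clauses only have to be sound over `ℕ`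
(`sat_evalAxioms`) and strong enough to derive every true fact about numerals
(`evals_num`): no uniqueness of `z`, `s` or of values is needed. Adding, for a universal
code `u`, the clause "`u` has no value at `n`" gives a formula which is satisfied by the standard
model if `u` is undefined at `n`, and by no model otherwise (`satisfiable_reduction_iff`).
-/

namespace FOML

open Nat.Partrec (Code)
open Encodable (encode)

/-! ### Quantifier-free formulas -/

/-- Implication. -/
def Form.imp (φ ψ : Form) : Form := .neg (.and φ (.neg ψ))

/-- The atom "`x` is zero". -/
def zeroF (x : ℕ) : Form := .atom 1 0 ![x]

/-- The atom "`x` is the number `n`", with one predicate symbol for every `n`. -/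
def numF (n x : ℕ) : Form := .atom 1 (n + 1) ![x]

/-- The atom "`y` is the successor of `x`". -/
def succF (x y : ℕ) : Form := .atom 2 0 ![x, y]

/-- The atom "`x` is less than `y`". -/
def ltF (x y : ℕ) : Form := .atom 2 1 ![x, y]

/-- The atom "the function with code `c` has value `y` at `x`", with one predicate symbol for
every code. -/
def evalF (c : Code) (x y : ℕ) : Form := .atom 2 (encode c + 2) ![x, y]

/-- The atom "`z` is the code of the pair of `x` and `y`". -/
def pairF (x y z : ℕ) : Form := .atom 3 0 ![x, y, z]

namespace Model

variable (M : Model) (w : M.World)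

/-- The interpretation of `zeroF` at the world `w`. -/
def IsZero (a : M.Dom) : Prop := ![a] ∈ M.ρ w 1 0

/-- The interpretation of `numF` at the world `w`. -/
def IsNum (n : ℕ) (a : M.Dom) : Prop := ![a] ∈ M.ρ w 1 (n + 1)

/-- The interpretation of `succF` at the world `w`. -/
def IsSucc (a b : M.Dom) : Prop := ![a, b] ∈ M.ρ w 2 0

/-- The interpretation of `ltF` at the world `w`. -/
def IsLt (a b : M.Dom) : Prop := ![a, b] ∈ M.ρ w 2 1

/-- The interpretation of `evalF` at the world `w`. -/
def Evals (c : Code) (a b : M.Dom) : Prop := ![a, b] ∈ M.ρ w 2 (encode c + 2)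

/-- The interpretation of `pairF` at the world `w`. -/
def IsPair (a b c : M.Dom) : Prop := ![a, b, c] ∈ M.ρ w 3 0

variable {M w} {σ : ℕ → M.Dom}

theorem sat_neg {φ : Form} : M.Sat w σ (.neg φ) ↔ ¬ M.Sat w σ φ := Iff.rfl

theorem sat_and {φ ψ : Form} : M.Sat w σ (.and φ ψ) ↔ M.Sat w σ φ ∧ M.Sat w σ ψ := Iff.rfl

theorem sat_ex {x : ℕ} {φ : Form} :
    M.Sat w σ (.ex x φ) ↔ ∃ d ∈ M.δ w, M.Sat w (Function.update σ x d) φ := Iff.rfl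

theorem sat_box {φ : Form} : M.Sat w σ (.box φ) ↔ ∀ u, M.R w u → M.Sat u σ φ := Iff.rfl

theorem sat_imp {φ ψ : Form} : M.Sat w σ (φ.imp ψ) ↔ (M.Sat w σ φ → M.Sat w σ ψ) := by
  simp [Form.imp, sat_neg, sat_and]

theorem sat_all {x : ℕ} {φ : Form} :
    M.Sat w σ (.all x φ) ↔ ∀ d ∈ M.δ w, M.Sat w (Function.update σ x d) φ := by
  simp [Form.all, sat_neg, sat_ex]

theorem sat_atom_one {P x : ℕ} : M.Sat w σ (.atom 1 P ![x]) ↔ ![σ x] ∈ M.ρ w 1 P := by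
  have : (fun i => σ (![x] i)) = ![σ x] := by ext i; fin_cases i; rfl
  rw [Sat, this]

theorem sat_atom_two {P x y : ℕ} :
    M.Sat w σ (.atom 2 P ![x, y]) ↔ ![σ x, σ y] ∈ M.ρ w 2 P := by
  have : (fun i => σ (![x, y] i)) = ![σ x, σ y] := by ext i; fin_cases i <;> rfl
  rw [Sat, this]

theorem sat_zeroF {x : ℕ} : M.Sat w σ (zeroF x) ↔ M.IsZero w (σ x) := sat_atom_one

theorem sat_numF {n x : ℕ} : M.Sat w σ (numF n x) ↔ M.IsNum w n (σ x) := sat_atom_one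

theorem sat_succF {x y : ℕ} : M.Sat w σ (succF x y) ↔ M.IsSucc w (σ x) (σ y) := sat_atom_two

theorem sat_ltF {x y : ℕ} : M.Sat w σ (ltF x y) ↔ M.IsLt w (σ x) (σ y) := sat_atom_two

theorem sat_evalF {c : Code} {x y : ℕ} :
    M.Sat w σ (evalF c x y) ↔ M.Evals w c (σ x) (σ y) := sat_atom_two

theorem sat_pairF {x y z : ℕ} :
    M.Sat w σ (pairF x y z) ↔ M.IsPair w (σ x) (σ y) (σ z) := by
  have : (fun i => σ (![x, y, z] i)) = ![σ x, σ y, σ z] := by ext i; fin_cases i <;> rfl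
  rw [pairF, Sat, this, IsPair]

end Model

open Model

/-! ### Horn clauses for partial recursive functions -/

/-- Horn clauses for `<` and `Nat.pair`. The clauses for `Nat.pair` enumerate the pairs in the order
of their codes: the four last ones lead from a pair to the next one. -/
def pairAxioms : Form :=
  .and ((succF 0 1).imp (ltF 0 1)) <|
  .and ((Form.and (ltF 0 1) (succF 1 2)).imp (ltF 0 2)) <|
  .and ((zeroF 0).imp (pairF 0 0 0)) <|
  .and ((Form.and (pairF 0 0 1) (.and (succF 0 2) (.and (succF 1 3) (zeroF 4)))).imp
    (pairF 4 2 3)) <|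
  .and ((Form.and (pairF 0 1 2) (.and (succF 0 3) (.and (ltF 3 1) (succF 2 4)))).imp
    (pairF 3 1 4)) <|
  .and ((Form.and (pairF 0 1 2) (.and (succF 0 1) (.and (succF 2 3) (zeroF 4)))).imp
    (pairF 1 4 3)) <|
  (Form.and (pairF 0 1 2) (.and (ltF 1 0) (.and (succF 1 3) (succF 2 4)))).imp (pairF 0 3 4)

/-- Horn clauses for the partial recursive function with code `c` and for those with codes that
occur in `c`. -/
def evalAxioms : Code → Form
  | .zero => (zeroF 1).imp (evalF .zero 0 1)
  | .succ => (succF 0 1).imp (evalF .succ 0 1)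
  | .left => (pairF 0 1 2).imp (evalF .left 2 0)
  | .right => (pairF 0 1 2).imp (evalF .right 2 1)
  | .pair f g => .and (.and (evalAxioms f) (evalAxioms g)) <|
      (Form.and (evalF f 0 1) (.and (evalF g 0 2) (pairF 1 2 3))).imp (evalF (.pair f g) 0 3)
  | .comp f g => .and (.and (evalAxioms f) (evalAxioms g)) <|
      (Form.and (evalF g 0 1) (evalF f 1 2)).imp (evalF (.comp f g) 0 2)
  | .prec f g => .and (.and (evalAxioms f) (evalAxioms g)) <|
      .and ((Form.and (pairF 0 1 2) (.and (zeroF 1) (evalF f 0 3))).imp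
        (evalF (.prec f g) 2 3)) <|
      -- `a`, `y`, `(a, y)`, the value `i` at `(a, y)`, `(y, i)`, `(a, (y, i))`, the next value,
      -- `y + 1` and `(a, y + 1)` are the values of the variables `0`, …, `8`
      (Form.and (pairF 0 1 2) (.and (evalF (.prec f g) 2 3) (.and (pairF 1 3 4)
        (.and (pairF 0 4 5) (.and (evalF g 5 6) (.and (succF 1 7) (pairF 0 7 8))))))).imp
        (evalF (.prec f g) 8 6)
  | .rfind' f => .and (evalAxioms f) <|
      .and ((Form.and (pairF 0 1 2) (.and (zeroF 3) (evalF f 2 3))).imp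
        (evalF (.rfind' f) 2 1)) <|
      -- if `f` has the positive value `4` at `(a, m)`, the search goes on at `(a, m + 1)`
      (Form.and (pairF 0 1 2) (.and (succF 3 4) (.and (evalF f 2 4) (.and (succF 1 5)
        (.and (pairF 0 5 6) (evalF (.rfind' f) 6 7)))))).imp
        (evalF (.rfind' f) 2 7)

/-- The clauses for `c`, together with clauses that define the numerals up to `n`. -/
def axiomsUpTo (c : Code) : ℕ → Form
  | 0 => .and ((zeroF 0).imp (numF 0 0)) (.and pairAxioms (evalAxioms c))
  | n + 1 => .and ((Form.and (numF n 0) (succF 0 1)).imp (numF (n + 1) 1)) (axiomsUpTo c n)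

/-- The quantifier-free formula which says that the function with code `c` has no value at `n`. -/
def noValue (c : Code) (n : ℕ) : Form :=
  .and (.neg (.and (numF n 0) (evalF c 0 1))) (axiomsUpTo c n)

/-! ### The formula of the reduction -/

/-- `□ ⋯ □ φ`, with `k` boxes. -/
def boxes : ℕ → Form → Form
  | 0, φ => φ
  | k + 1, φ => .box (boxes k φ)

/-- `∀ xₖ₋₁ □ ⋯ ∀ x₀ □ φ`. -/
def allBoxes : ℕ → Form → Form
  | 0, φ => φ
  | k + 1, φ => .all k (.box (allBoxes k φ))

/-- A contradiction. -/
def falsum : Form := .and (zeroF 0) (.neg (zeroF 0))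

/-- `◇ ∀ x (∃ y □⁹ succ(x, y) ∧ ∃ y □⁹ zero(y) ∧ ◇⁹ ⊤ ∧ ∀ x₈ □ ⋯ ∀ x₀ □ φ)`. The clauses of
`noValue` use the nine variables `0`, …, `8`, whence the number of boxes. -/
def closure (φ : Form) : Form :=
  .neg <| .box <| .ex 0 <| .neg <|
    .and (.ex 1 (.box (boxes 8 (succF 0 1)))) <|
    .and (.ex 1 (.box (boxes 8 (zeroF 1)))) <|
    .and (.neg (boxes 9 falsum)) <|
    allBoxes 9 φ

/-- The formula that is satisfiable if and only if `c` has no value at `n`. -/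
def reduction (c : Code) (n : ℕ) : Form := closure (noValue c n)

section Fragment

variable {B : Set Bundle} {φ ψ : Form}

theorem IsBundled.imp (h : IsBundled B φ) (k : IsBundled B ψ) : IsBundled B (φ.imp ψ) :=
  .neg (.and h (.neg k))

theorem isBundled_pairAxioms : IsBundled B pairAxioms := by
  unfold pairAxioms
  repeat' first | apply IsBundled.atom | apply IsBundled.imp | apply IsBundled.and

theorem isBundled_evalAxioms (c : Code) : IsBundled B (evalAxioms c) := by
  induction c <;> unfold evalAxioms <;>
    repeat' first | assumption | apply IsBundled.atom | apply IsBundled.imp | apply IsBundled.and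

theorem isBundled_axiomsUpTo (c : Code) (n : ℕ) : IsBundled B (axiomsUpTo c n) := by
  induction n with
  | zero =>
    exact .and (.imp (.atom ..) (.atom ..)) (.and isBundled_pairAxioms (isBundled_evalAxioms c))
  | succ n ih => exact .and (.imp (.and (.atom ..) (.atom ..)) (.atom ..)) ih

theorem isBundled_boxes (h : IsBundled B φ) (k : ℕ) : IsBundled B (boxes k φ) := by
  induction k with
  | zero => exact h
  | succ k ih => exact .box ih

theorem isBundled_allBoxes (hB : .allBox ∈ B) (h : IsBundled B φ) (k : ℕ) :
    IsBundled B (allBoxes k φ) := by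
  induction k with
  | zero => exact h
  | succ k ih => exact .bundle .allBox hB k ih

theorem reduction_mem_ABEBBE (c : Code) (n : ℕ) : reduction c n ∈ ABEBBE := by
  refine .neg (.bundle .boxEx (by simp) 0 (.neg (.and ?_ (.and ?_ (.and ?_ ?_)))))
  · exact .bundle .exBox (by simp) 1 (isBundled_boxes (.atom ..) 8)
  · exact .bundle .exBox (by simp) 1 (isBundled_boxes (.atom ..) 8)
  · exact .neg (isBundled_boxes (.and (.atom ..) (.neg (.atom ..))) 9)
  · exact isBundled_allBoxes (by simp)
      (.and (.neg (.and (.atom ..) (.atom ..))) (isBundled_axiomsUpTo c n)) 9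

end Fragment

/-! ### Arithmetic of pairs and of unbounded search -/

theorem pair_zero_succ (a : ℕ) : Nat.pair 0 (a + 1) = Nat.pair a a + 1 := by
  simp [Nat.pair]; ring

theorem pair_succ_left {a b : ℕ} (h : a + 1 < b) : Nat.pair (a + 1) b = Nat.pair a b + 1 := by
  rw [Nat.pair, Nat.pair, if_pos h, if_pos (by omega), add_assoc]

theorem pair_succ_zero (a : ℕ) : Nat.pair (a + 1) 0 = Nat.pair a (a + 1) + 1 := by
  simp [Nat.pair]; ring

theorem pair_succ_right {a b : ℕ} (h : b < a) : Nat.pair a (b + 1) = Nat.pair a b + 1 := by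
  rw [Nat.pair, Nat.pair, if_neg (by omega), if_neg (by omega), ← add_assoc]

theorem mem_eval_rfind' {f : Code} {a m y : ℕ} :
    y ∈ (Code.rfind' f).eval (Nat.pair a m) ↔ ∃ n, y = n + m ∧
      0 ∈ f.eval (Nat.pair a (n + m)) ∧ ∀ k < n, ∃ r, r + 1 ∈ f.eval (Nat.pair a (k + m)) := by
  have h1 (x : Part ℕ) : (true ∈ (fun m => decide (m = 0)) <$> x) ↔ 0 ∈ x := by simp
  have h2 (x : Part ℕ) : (false ∈ (fun m => decide (m = 0)) <$> x) ↔ ∃ r, r + 1 ∈ x := by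
    simp only [Part.map_eq_map, Part.mem_map_iff, decide_eq_false_iff_not]
    constructor
    · rintro ⟨r, hr, h⟩
      exact ⟨r - 1, by rwa [Nat.sub_add_cancel (by omega)]⟩
    · rintro ⟨r, hr⟩
      exact ⟨_, hr, by omega⟩
  rw [Code.eval, Nat.unpaired, Nat.unpair_pair]
  refine (Part.mem_map_iff _).trans ⟨?_, ?_⟩
  · rintro ⟨n, hn, rfl⟩
    obtain ⟨h0, h⟩ := Nat.mem_rfind.1 hn
    exact ⟨n, rfl, (h1 _).1 h0, fun k hk => (h2 _).1 (h hk)⟩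
  · rintro ⟨n, rfl, h0, h⟩
    exact ⟨n, Nat.mem_rfind.2 ⟨(h1 _).2 h0, fun hk => (h2 _).2 (h _ hk)⟩, rfl⟩

theorem mem_eval_pair {f g : Code} {n y : ℕ} :
    y ∈ (Code.pair f g).eval n ↔
      ∃ a ∈ f.eval n, ∃ b ∈ g.eval n, Nat.pair a b = y := by
  simp [Code.eval, Seq.seq]

theorem mem_eval_comp {f g : Code} {n y : ℕ} :
    y ∈ (Code.comp f g).eval n ↔ ∃ a ∈ g.eval n, y ∈ f.eval a :=
  Part.mem_bind_iff

theorem mem_eval_prec_succ {f g : Code} {a n y : ℕ} :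
    y ∈ (Code.prec f g).eval (Nat.pair a (n + 1)) ↔
      ∃ i ∈ (Code.prec f g).eval (Nat.pair a n), y ∈ g.eval (Nat.pair a (Nat.pair n i)) := by
  simp [Code.eval_prec_succ]

/-! ### The standard model -/

/-- The model with one reflexive world and domain `ℕ` where all predicate symbols have their
intended meaning. It is reducible so that its domain unifies with `ℕ`. -/
abbrev standard : Model where
  World := Unit
  Dom := ℕ
  δ _ := Set.univ
  R _ _ := True
  ρ _ n P := match n, P with
    | 1, 0 => {a | a 0 = 0}
    | 1, n + 1 => {a | a 0 = n}
    | 2, 0 => {a | a 1 = a 0 + 1}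
    | 2, 1 => {a | a 0 < a 1}
    | 2, k + 2 => {a | a 1 ∈ (Denumerable.ofNat Code k).eval (a 0)}
    | 3, _ => {a | a 2 = Nat.pair (a 0) (a 1)}
    | _, _ => ∅
  δ_nonempty _ := Set.univ_nonempty
  δ_mono _ _ _ := subset_rfl
  ρ_local _ _ _ _ _ _ := trivial

section Standard

variable {w : standard.World} {σ : ℕ → ℕ}

theorem isZero_standard {a : ℕ} : standard.IsZero w a ↔ a = 0 := Iff.rfl

theorem isNum_standard {n a : ℕ} : standard.IsNum w n a ↔ a = n := Iff.rfl

theorem isSucc_standard {a b : ℕ} : standard.IsSucc w a b ↔ b = a + 1 := Iff.rfl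

theorem isLt_standard {a b : ℕ} : standard.IsLt w a b ↔ a < b := Iff.rfl

theorem isPair_standard {a b c : ℕ} : standard.IsPair w a b c ↔ c = Nat.pair a b := Iff.rfl

theorem evals_standard {c : Code} {a b : ℕ} : standard.Evals w c a b ↔ b ∈ c.eval a := by
  change b ∈ (Denumerable.ofNat Code (encode c)).eval a ↔ _
  rw [Denumerable.ofNat_encode]

theorem sat_pairAxioms : standard.Sat w σ pairAxioms := by
  simp only [pairAxioms, sat_and, sat_imp, sat_ltF, sat_succF, sat_zeroF, sat_pairF,
    isZero_standard, isSucc_standard, isLt_standard, isPair_standard]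
  refine ⟨fun h => by omega, fun h => by omega, fun h => by rw [h]; rfl, ?_, ?_, ?_, ?_⟩
  · rintro ⟨h1, h2, h3, h4⟩
    rw [h4, h2, h3, h1, pair_zero_succ]
  · rintro ⟨h1, h2, h3, h4⟩
    rw [h2] at h3 ⊢
    rw [pair_succ_left h3, h4, h1]
  · rintro ⟨h1, h2, h3, h4⟩
    rw [h4, h3, h1, h2, pair_succ_zero]
  · rintro ⟨h1, h2, h3, h4⟩
    rw [h4, h3, h1, pair_succ_right h2]

theorem sat_evalAxioms (c : Code) : standard.Sat w σ (evalAxioms c) := by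
  induction c with
  | zero =>
    simp only [evalAxioms, sat_imp, sat_zeroF, sat_evalF, isZero_standard, evals_standard]
    intro h
    simp [h, Code.eval, pure, PFun.pure]
  | succ =>
    simp only [evalAxioms, sat_imp, sat_succF, sat_evalF, isSucc_standard, evals_standard]
    intro h
    simp [h, Code.eval]
  | left =>
    simp only [evalAxioms, sat_imp, sat_pairF, sat_evalF, isPair_standard, evals_standard]
    intro h
    simp [h, Code.eval]
  | right =>
    simp only [evalAxioms, sat_imp, sat_pairF, sat_evalF, isPair_standard, evals_standard]
    intro h
    simp [h, Code.eval]
  | pair f g hf hg =>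
    refine ⟨⟨hf, hg⟩, ?_⟩
    simp only [sat_imp, sat_and, sat_pairF, sat_evalF, isPair_standard, evals_standard,
      mem_eval_pair]
    rintro ⟨h1, h2, h3⟩
    exact ⟨_, h1, _, h2, h3.symm⟩
  | comp f g hf hg =>
    refine ⟨⟨hf, hg⟩, ?_⟩
    simp only [sat_imp, sat_and, sat_evalF, evals_standard, mem_eval_comp]
    rintro ⟨h1, h2⟩
    exact ⟨_, h1, h2⟩
  | prec f g hf hg =>
    refine ⟨⟨hf, hg⟩, ?_⟩
    simp only [sat_imp, sat_and, sat_pairF, sat_zeroF, sat_succF, sat_evalF, isPair_standard,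
      isZero_standard, isSucc_standard, evals_standard]
    constructor
    · rintro ⟨h1, h2, h3⟩
      rw [h1, h2, Code.eval_prec_zero]
      exact h3
    · rintro ⟨h1, h2, h3, h4, h5, h6, h7⟩
      rw [h7, h6, mem_eval_prec_succ]
      rw [h1] at h2
      rw [h4, h3] at h5
      exact ⟨_, h2, h5⟩
  | rfind' f hf =>
    refine ⟨hf, ?_⟩
    simp only [sat_imp, sat_and, sat_pairF, sat_zeroF, sat_succF, sat_evalF, isPair_standard,
      isZero_standard, isSucc_standard, evals_standard]
    constructor
    · rintro ⟨h1, h2, h3⟩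
      rw [h1, mem_eval_rfind']
      refine ⟨0, by simp, ?_, by simp⟩
      rw [h1, h2] at h3
      simpa using h3
    · rintro ⟨h1, h2, h3, h4, h5, h6⟩
      rw [h5, h4, mem_eval_rfind'] at h6
      obtain ⟨n, hn, h0, h⟩ := h6
      rw [h1, h2] at h3
      rw [h1, mem_eval_rfind']
      refine ⟨n + 1, by omega, by rwa [add_right_comm, add_assoc], fun k hk => ?_⟩
      obtain _ | k := k
      · exact ⟨_, by simpa using h3⟩
      · obtain ⟨r, hr⟩ := h k (by omega)
        exact ⟨r, by rwa [add_right_comm, add_assoc]⟩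

theorem sat_axiomsUpTo (c : Code) (n : ℕ) : standard.Sat w σ (axiomsUpTo c n) := by
  induction n with
  | zero =>
    refine ⟨?_, sat_pairAxioms, sat_evalAxioms c⟩
    simp only [sat_imp, sat_zeroF, sat_numF, isZero_standard, isNum_standard, imp_self]
  | succ n ih =>
    refine ⟨?_, ih⟩
    simp only [sat_imp, sat_and, sat_succF, sat_numF, isSucc_standard, isNum_standard]
    omega

theorem sat_noValue {c : Code} {n : ℕ} (h : ¬ (c.eval n).Dom) :
    standard.Sat w σ (noValue c n) := by
  refine ⟨?_, sat_axiomsUpTo c n⟩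
  simp only [sat_neg, sat_and, sat_numF, sat_evalF, isNum_standard, evals_standard]
  rintro ⟨h1, h2⟩
  rw [h1] at h2
  exact h (Part.dom_iff_mem.2 ⟨_, h2⟩)

theorem sat_boxes_standard {φ : Form} (k : ℕ) :
    standard.Sat w σ (boxes k φ) ↔ standard.Sat w σ φ := by
  induction k with
  | zero => rfl
  | succ k ih => exact ⟨fun h => ih.1 (h w trivial), fun h _ _ => ih.2 h⟩

theorem sat_allBoxes_standard {φ : Form} (h : ∀ σ, standard.Sat w σ φ) (k : ℕ) :
    standard.Sat w σ (allBoxes k φ) := by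
  induction k generalizing σ with
  | zero => exact h σ
  | succ k ih => exact sat_all.2 fun _ _ _ _ => ih

theorem satisfiable_closure {φ : Form} (h : ∀ σ, standard.Sat () σ φ) :
    Satisfiable (closure φ) := by
  refine ⟨standard, (), fun _ => (0 : ℕ), fun _ => trivial, fun hbox => ?_⟩
  obtain ⟨d, -, hd⟩ := hbox () trivial
  refine hd ⟨⟨Nat.succ d, trivial, ?_⟩, ⟨(0 : ℕ), trivial, ?_⟩, ?_, sat_allBoxes_standard h 9⟩
  · refine (sat_boxes_standard 9).2 (sat_succF.2 ?_)
    simp [isSucc_standard]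
  · refine (sat_boxes_standard 9).2 (sat_zeroF.2 ?_)
    simp [isZero_standard]
  · exact fun h => ((sat_boxes_standard 9).1 h).2 ((sat_boxes_standard 9).1 h).1

end Standard

/-! ### Numerals in an arbitrary model -/

/-- `M.Steps k w t`: the world `t` can be reached from `w` in exactly `k` steps. -/
def Model.Steps (M : Model) : ℕ → M.World → M.World → Prop
  | 0, w, t => w = t
  | k + 1, w, t => ∃ u, M.R w u ∧ M.Steps k u t

section Numerals

variable {M : Model} {w t : M.World} {σ : ℕ → M.Dom}

theorem sat_boxes_iff {φ : Form} {k : ℕ} :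
    M.Sat w σ (boxes k φ) ↔ ∀ t, M.Steps k w t → M.Sat t σ φ := by
  induction k generalizing w with
  | zero => simp [boxes, Steps]
  | succ k ih =>
    simp only [boxes, sat_box, ih, Steps]
    exact ⟨fun h t ⟨u, hu, ht⟩ => h u hu t ht, fun h u hu t ht => h t ⟨u, hu, ht⟩⟩

/-- Nested bundles `∀ x □` impose their matrix on all tuples from the first local domain. -/
theorem Model.Sat.of_allBoxes {φ : Form} {k : ℕ} (h : M.Sat w σ (allBoxes k φ))
    (ht : M.Steps k w t) {τ : ℕ → M.Dom} (hτ : ∀ i < k, τ i ∈ M.δ w)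
    (hσ : ∀ i ≥ k, τ i = σ i) : M.Sat t τ φ := by
  induction k generalizing w σ with
  | zero =>
    obtain rfl : τ = σ := funext fun i => hσ i (by omega)
    obtain rfl : w = t := ht
    exact h
  | succ k ih =>
    obtain ⟨u, hu, ht⟩ := ht
    refine ih (sat_all.1 h (τ k) (hτ k (by omega)) u hu) ht
      (fun i hi => M.δ_mono w u hu (hτ i (by omega))) fun i hi => ?_
    obtain rfl | hi := hi.eq_or_lt
    · simp
    · rw [Function.update_of_ne (by omega), hσ i hi]

/-- The quantifier-free formula `φ` holds at `w` whenever the values of the variables `0`, …, `8`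
are among the elements `num 0`, `num 1`, …; the other variables have their values under `σ`. -/
def HoldsOnNumerals (M : Model) (w : M.World) (σ : ℕ → M.Dom) (num : ℕ → M.Dom) (φ : Form) :
    Prop :=
  ∀ f : ℕ → ℕ, M.Sat w (fun i => if i < 9 then num (f i) else σ i) φ

variable {num : ℕ → M.Dom}

theorem HoldsOnNumerals.left {φ ψ : Form} (h : HoldsOnNumerals M w σ num (.and φ ψ)) :
    HoldsOnNumerals M w σ num φ := fun f => (h f).1

theorem HoldsOnNumerals.right {φ ψ : Form} (h : HoldsOnNumerals M w σ num (.and φ ψ)) :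
    HoldsOnNumerals M w σ num ψ := fun f => (h f).2

/-- An instance of a clause, with the values of the variables given by a list of numbers. -/
theorem HoldsOnNumerals.imp {φ ψ : Form} (h : HoldsOnNumerals M w σ num (φ.imp ψ))
    (l : List ℕ) :
    M.Sat w (fun i => if i < 9 then num (l.getD i 0) else σ i) φ →
      M.Sat w (fun i => if i < 9 then num (l.getD i 0) else σ i) ψ :=
  sat_imp.1 (h fun i => l.getD i 0)

variable (hZ : M.IsZero w (num 0)) (hS : ∀ n, M.IsSucc w (num n) (num (n + 1)))
  (hP : HoldsOnNumerals M w σ num pairAxioms)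

include hS hP in
theorem isLt_num {a b : ℕ} (h : a < b) : M.IsLt w (num a) (num b) := by
  induction b, h using Nat.le_induction with
  | base => exact (sat_ltF.1 (hP.left.imp [a, a + 1] (sat_succF.2 (hS a))) :)
  | succ b hb ih =>
    exact (sat_ltF.1 (hP.right.left.imp [a, b, b + 1] ⟨sat_ltF.2 ih, sat_succF.2 (hS b)⟩) :)

include hZ hS hP in
theorem isPair_num (a b : ℕ) : M.IsPair w (num a) (num b) (num (Nat.pair a b)) := by
  obtain ⟨p, hp⟩ : ∃ p, Nat.pair a b = p := ⟨_, rfl⟩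
  rw [hp]
  induction p generalizing a b with
  | zero =>
    have h := hP.right.right.left.imp [0] (sat_zeroF.2 hZ)
    have hab : Nat.pair a b = Nat.pair 0 0 := hp
    obtain ⟨rfl, rfl⟩ := Nat.pair_eq_pair.1 hab
    exact (sat_pairF.1 h :)
  | succ p ih =>
    -- the pair with code `p + 1` is the successor, in the enumeration, of the pair with code `p`
    obtain ⟨⟨c, d⟩, hcd⟩ : ∃ x : ℕ × ℕ, Nat.pair x.1 x.2 = p := ⟨p.unpair, Nat.pair_unpair p⟩
    simp only at hcd
    have key {a' b' : ℕ} (h : Nat.pair a' b' = Nat.pair c d + 1) : a' = a ∧ b' = b :=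
      Nat.pair_eq_pair.1 (by rw [h, hcd, hp])
    have hc := ih c d hcd
    obtain rfl | h : c = d ∨ c ≠ d := eq_or_ne c d
    · obtain ⟨rfl, rfl⟩ := key (pair_zero_succ c)
      exact (sat_pairF.1 (hP.right.right.right.left.imp [c, p, c + 1, p + 1, 0]
        ⟨sat_pairF.2 hc, sat_succF.2 (hS c), sat_succF.2 (hS p), sat_zeroF.2 hZ⟩) :)
    obtain h | h := h.lt_or_gt
    · obtain h | rfl := (Nat.succ_le_of_lt h).lt_or_eq
      · obtain ⟨rfl, rfl⟩ := key (pair_succ_left h)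
        exact (sat_pairF.1 (hP.right.right.right.right.left.imp [c, d, p, c + 1, p + 1]
          ⟨sat_pairF.2 hc, sat_succF.2 (hS c), sat_ltF.2 (isLt_num hS hP h), sat_succF.2 (hS p)⟩) :)
      · obtain ⟨rfl, rfl⟩ := key (pair_succ_zero c)
        exact (sat_pairF.1 (hP.right.right.right.right.right.left.imp [c, c + 1, p, p + 1, 0]
          ⟨sat_pairF.2 hc, sat_succF.2 (hS c), sat_succF.2 (hS p), sat_zeroF.2 hZ⟩) :)
    · obtain ⟨rfl, rfl⟩ := key (pair_succ_right h)
      exact (sat_pairF.1 (hP.right.right.right.right.right.right.imp [c, d, p, d + 1, p + 1]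
        ⟨sat_pairF.2 hc, sat_ltF.2 (isLt_num hS hP h), sat_succF.2 (hS d), sat_succF.2 (hS p)⟩) :)

include hZ hS hP in
/-- The Horn clauses for `c` derive all true facts about the values of `c` at numerals. -/
theorem evals_num {c : Code} (hc : HoldsOnNumerals M w σ num (evalAxioms c)) {n y : ℕ}
    (h : y ∈ c.eval n) : M.Evals w c (num n) (num y) := by
  have hp (a b : ℕ) := isPair_num hZ hS hP a b
  obtain ⟨⟨a, b⟩, rfl⟩ : ∃ x : ℕ × ℕ, Nat.pair x.1 x.2 = n := ⟨n.unpair, Nat.pair_unpair n⟩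
  simp only at h ⊢
  induction c generalizing a b y with
  | zero =>
    obtain rfl : y = 0 := by simpa [Code.eval, pure, PFun.pure] using h
    exact (sat_evalF.1 (hc.imp [Nat.pair a b, 0] (sat_zeroF.2 hZ)) :)
  | succ =>
    obtain rfl : y = Nat.pair a b + 1 := by simpa [Code.eval] using h
    exact (sat_evalF.1 (hc.imp [Nat.pair a b, Nat.pair a b + 1] (sat_succF.2 (hS _))) :)
  | left =>
    obtain rfl : y = a := by simpa [Code.eval] using h
    exact (sat_evalF.1 (hc.imp [y, b, Nat.pair y b] (sat_pairF.2 (hp _ _))) :)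
  | right =>
    obtain rfl : y = b := by simpa [Code.eval] using h
    exact (sat_evalF.1 (hc.imp [a, y, Nat.pair a y] (sat_pairF.2 (hp _ _))) :)
  | pair f g hf hg =>
    obtain ⟨i, hi, j, hj, rfl⟩ := mem_eval_pair.1 h
    exact (sat_evalF.1 (hc.right.imp [Nat.pair a b, i, j, Nat.pair i j]
      ⟨sat_evalF.2 (hf hc.left.left a b hi), sat_evalF.2 (hg hc.left.right a b hj),
        sat_pairF.2 (hp i j)⟩) :)
  | comp f g hf hg =>
    obtain ⟨i, hi, hy⟩ := mem_eval_comp.1 h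
    have hy' := hf hc.left.left i.unpair.1 i.unpair.2 (y := y) (by rwa [Nat.pair_unpair])
    rw [Nat.pair_unpair] at hy'
    exact (sat_evalF.1 (hc.right.imp [Nat.pair a b, i, y]
      ⟨sat_evalF.2 (hg hc.left.right a b hi), sat_evalF.2 hy'⟩) :)
  | prec f g hf hg =>
    induction b generalizing y with
    | zero =>
      rw [Code.eval_prec_zero] at h
      have hy := hf hc.left.left a.unpair.1 a.unpair.2 (y := y) (by rwa [Nat.pair_unpair])
      rw [Nat.pair_unpair] at hy
      exact (sat_evalF.1 (hc.right.left.imp [a, 0, Nat.pair a 0, y]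
        ⟨sat_pairF.2 (hp a 0), sat_zeroF.2 hZ, sat_evalF.2 hy⟩) :)
    | succ b ih =>
      obtain ⟨i, hi, hy⟩ := mem_eval_prec_succ.1 h
      exact (sat_evalF.1 (hc.right.right.imp
        [a, b, Nat.pair a b, i, Nat.pair b i, Nat.pair a (Nat.pair b i), y, b + 1,
          Nat.pair a (b + 1)]
        ⟨sat_pairF.2 (hp _ _), sat_evalF.2 (ih hi), sat_pairF.2 (hp _ _), sat_pairF.2 (hp _ _),
          sat_evalF.2 (hg hc.left.right _ _ hy), sat_succF.2 (hS _), sat_pairF.2 (hp _ _)⟩) :)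
  | rfind' f hf =>
    obtain ⟨n, rfl, h0, h⟩ := mem_eval_rfind'.1 h
    clear * - hZ hS hP hc hf hp h0 h
    induction n generalizing b with
    | zero =>
      rw [zero_add] at h0 ⊢
      exact (sat_evalF.1 (hc.right.left.imp [a, b, Nat.pair a b, 0]
        ⟨sat_pairF.2 (hp _ _), sat_zeroF.2 hZ, sat_evalF.2 (hf hc.left _ _ h0)⟩) :)
    | succ n ih =>
      obtain ⟨r, hr⟩ := h 0 (by omega)
      rw [zero_add] at hr
      have hn := ih (b + 1) (by rwa [← add_assoc, add_right_comm]) fun k hk => by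
        rw [← add_assoc, add_right_comm]
        exact h (k + 1) (by omega)
      rw [← add_assoc, add_right_comm] at hn
      exact (sat_evalF.1 (hc.right.right.imp
        [a, b, Nat.pair a b, r, r + 1, b + 1, Nat.pair a (b + 1), n + 1 + b]
        ⟨sat_pairF.2 (hp _ _), sat_succF.2 (hS _), sat_evalF.2 (hf hc.left _ _ hr),
          sat_succF.2 (hS _), sat_pairF.2 (hp _ _), sat_evalF.2 hn⟩) :)

theorem HoldsOnNumerals.of_axiomsUpTo {c : Code} {n : ℕ}
    (h : HoldsOnNumerals M w σ num (axiomsUpTo c n)) :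
    HoldsOnNumerals M w σ num (.and pairAxioms (evalAxioms c)) := by
  induction n with
  | zero => exact h.right
  | succ n ih => exact ih h.right

include hZ hS in
theorem isNum_num {c : Code} {n : ℕ} (h : HoldsOnNumerals M w σ num (axiomsUpTo c n)) :
    M.IsNum w n (num n) := by
  induction n with
  | zero => exact (sat_numF.1 (h.left.imp [0] (sat_zeroF.2 hZ)) :)
  | succ n ih =>
    exact (sat_numF.1 (h.left.imp [n, n + 1] ⟨sat_numF.2 (ih h.right), sat_succF.2 (hS n)⟩) :)

include hZ hS in
theorem HoldsOnNumerals.not_dom {c : Code} {n : ℕ}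
    (h : HoldsOnNumerals M w σ num (noValue c n)) : ¬ (c.eval n).Dom := by
  rw [Part.dom_iff_mem]
  rintro ⟨y, hy⟩
  have hc := h.right.of_axiomsUpTo
  exact h.left (fun i => [n, y].getD i 0)
    ⟨sat_numF.2 (isNum_num hZ hS h.right), sat_evalF.2 (evals_num hZ hS hc.left hc.right hy)⟩

end Numerals

theorem exists_holdsOnNumerals {φ : Form} (h : Satisfiable (closure φ)) :
    ∃ (M : Model) (w : M.World) (σ num : ℕ → M.Dom), M.IsZero w (num 0) ∧
      (∀ n, M.IsSucc w (num n) (num (n + 1))) ∧ HoldsOnNumerals M w σ num φ := by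
  obtain ⟨M, r, σ, -, hr⟩ := h
  obtain ⟨v, -, hv⟩ : ∃ v, M.R r v ∧ ∀ d ∈ M.δ v, M.Sat v (Function.update σ 0 d)
      (.and (.ex 1 (boxes 9 (succF 0 1))) <| .and (.ex 1 (boxes 9 (zeroF 1))) <|
        .and (.neg (boxes 9 falsum)) <| allBoxes 9 φ) := by
    by_contra! hcon
    exact hr hcon
  obtain ⟨d₀, hd₀⟩ := M.δ_nonempty v
  obtain ⟨-, ⟨z, hz, hzero⟩, hdia, hall⟩ := hv d₀ hd₀
  obtain ⟨t, ht⟩ : ∃ t, M.Steps 9 v t := by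
    by_contra! hcon
    exact hdia (sat_boxes_iff.2 fun t ht => absurd ht (hcon t))
  have hsucc (d : M.δ v) : ∃ e : M.δ v, M.IsSucc t d e := by
    obtain ⟨⟨e, he, hde⟩, -⟩ := hv d d.2
    exact ⟨⟨e, he⟩, by simpa using sat_succF.1 (sat_boxes_iff.1 hde t ht)⟩
  choose s hs using hsucc
  refine ⟨M, t, Function.update σ 0 d₀, fun n => (s^[n] ⟨z, hz⟩ : M.δ v), ?_, fun n => ?_,
    fun f => ?_⟩
  · simpa using sat_zeroF.1 (sat_boxes_iff.1 hzero t ht)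
  · simp only [Function.iterate_succ_apply']
    exact hs _
  · refine hall.of_allBoxes ht (fun i hi => ?_) fun i hi => ?_
    · simp only [if_pos hi]
      exact Subtype.coe_prop _
    · simp only [if_neg (not_lt.2 hi)]

theorem satisfiable_reduction_iff {c : Code} {n : ℕ} :
    Satisfiable (reduction c n) ↔ ¬ (c.eval n).Dom := by
  refine ⟨fun h => ?_, fun h => satisfiable_closure fun σ => sat_noValue h⟩
  obtain ⟨M, w, σ, num, hZ, hS, hφ⟩ := exists_holdsOnNumerals h
  exact hφ.not_dom hZ hS

/-! ### Computability of the reduction -/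

section Computability

open Primrec

/-- The formula `φ` comes last in `closure φ`, so its code is a suffix. -/
theorem code_closure :
    ∃ l : List ℕ, ∀ φ, (closure φ).code = l ++ φ.code := by
  have hall (k : ℕ) : ∃ l : List ℕ, ∀ φ, (allBoxes k φ).code = l ++ φ.code := by
    induction k with
    | zero => exact ⟨[], fun φ => rfl⟩
    | succ k ih =>
      obtain ⟨l, hl⟩ := ih
      exact ⟨1 :: 3 :: k :: 1 :: 4 :: l, fun φ => by simp [allBoxes, Form.all, Form.code, hl]⟩
  obtain ⟨l, hl⟩ := hall 9
  exact ⟨[1, 4, 3, 0, 1, 2] ++ (Form.ex 1 (boxes 9 (succF 0 1))).code ++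
    2 :: ((Form.ex 1 (boxes 9 (zeroF 1))).code ++ 2 :: ((Form.neg (boxes 9 falsum)).code ++ l)),
    fun φ => by simp [closure, boxes, Form.code, hl]⟩

theorem primrec_code_axiomsUpTo (c : Code) : Primrec fun n => (axiomsUpTo c n).code := by
  have hstep : Primrec₂ fun (n : ℕ) (l : List ℕ) =>
      [2, 1, 2, 2, 0, 1] ++ (n + 1) :: ([0, 0, 2, 0, 0, 1, 1, 0, 1] ++ (n + 2) :: 1 :: l) :=
    list_append.comp (.const _) (list_cons.comp (succ.comp fst)
      (list_append.comp (.const _) (list_cons.comp (succ.comp (succ.comp fst))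
        (list_cons.comp (.const _) snd))))
  refine (nat_rec₁ (axiomsUpTo c 0).code hstep).of_eq fun n => ?_
  induction n with
  | zero => rfl
  | succ n ih =>
    simp only at ih ⊢
    rw [ih]
    simp [axiomsUpTo, Form.imp, Form.code, numF, succF]

theorem primrec_code_reduction (c : Code) : Primrec fun n => (reduction c n).code := by
  obtain ⟨l, hl⟩ := code_closure
  have h : Primrec fun n : ℕ => l ++ ([2, 1, 2, 0, 1] ++ (n + 1) ::
      ((0 :: (evalF c 0 1).code) ++ (axiomsUpTo c n).code)) :=
    list_append.comp (.const _) (list_append.comp (.const _) (list_cons.comp succ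
      (list_append.comp (.const _) (primrec_code_axiomsUpTo c))))
  refine h.of_eq fun n => ?_
  rw [reduction, hl]
  simp [noValue, numF, Form.code]

end Computability

/-- A code of a partial recursive function whose domain is undecidable. -/
theorem exists_code_not_computablePred :
    ∃ u : Code, ¬ ComputablePred fun n => (u.eval n).Dom := by
  have hf : Partrec fun n : ℕ => (Denumerable.ofNat Code n).eval 0 :=
    Code.eval_part.comp (Computable.ofNat Code) (Computable.const 0)
  obtain ⟨u, hu⟩ := Code.exists_code.1 (Partrec.nat_iff.1 hf)
  refine ⟨u, fun h => ComputablePred.halting_problem 0 ?_⟩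
  obtain ⟨g, hg, hgu⟩ := ComputablePred.computable_iff.1 h
  refine ComputablePred.computable_iff.2 ⟨_, hg.comp Computable.encode, funext fun c => ?_⟩
  have := congrFun hgu (encode c)
  simpa only [hu, Denumerable.ofNat_encode] using this

end FOML

open FOML in
theorem mainTheorem3 : ¬ FOML.SatDecidable FOML.ABEBBE := by
  rintro ⟨A, hA, h⟩
  obtain ⟨u, hu⟩ := exists_code_not_computablePred
  refine hu (ComputablePred.computable_iff.2 ⟨fun n => !A (reduction u n).code,
    Primrec.not.to_comp.comp (hA.comp (primrec_code_reduction u).to_comp), funext fun n => ?_⟩)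
  have := h _ (reduction_mem_ABEBBE u n)
  rw [satisfiable_reduction_iff] at this
  simp only [Bool.not_eq_true', ← Bool.not_eq_true, this, not_not]
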